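/- **Setting.** Formulas are built from propositional variables by finitary connectives. Labels are nominals $\mathbf j$ and conominals $\mathbf m$ (infinitely many of each); terms are built from labels by finitary operation symbols. Structures are the labelled formulas $\mathbf j\le A$, $A\le\mathbf m$ and the pure structures $\mathbf j\le \mathbf T$, $\mathbf T\le\mathbf m$ (where $\mathbf j$, resp. $\mathbf m$, does not occur in the term $\mathbf T$). A sequent $\Gamma\vdash\Delta$ is a pair of finite multisets of structures. An occurrence of $\mathbf j\le X$ is in precedent (succedent) position if it is in $\Gamma$ (in $\Delta$); an occurrence of $X\le\mathbf m$ is in precedent (succedent) position if it is in $\Delta$ (in $\Gamma$). A label is in display in a sequent if every structure of the sequent in which it occurs is a labelled formula with that label, or has the form $\mathbf j\le\mathbf T$ (resp. $\mathbf T\le\mathbf m$) for that label, with the label not occurring in $\mathbf T$. A labelled formula is in display if its label is. A *labelled proof system* consists of a set of well-formed sequents and a set of inferences (instances of rules other than cut) between well-formed sequents, both closed under injective renaming of labels, and of the cut rule. Each inference comes with its analysis: some constituents are parameters; some constituents of premises are locally congruent to constituents of the conclusion; congruent constituents are both parameters, or are both nonparametric and the rule is a switch rule. In a switch rule, a label that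 is exchanged in a formula does not occur in the conclusion. A constituent of the conclusion is *principal* if it is not a parameter and the rule is not a switch rule. The *cut rule* derives $\Gamma,\Gamma'\vdash\Delta,\Delta'$, if well-formed, from two sequents containing in addition the same labelled formula $a$, in succedent position in the first and in precedent position in the second, provided that $a$ is in display in both premises and that, with respect to the kind (nominal or conominal) of the label of $a$, all principal uppermost occurrences congruent to $a$ in the two subderivations have a label of that kind ($a$ is a $\mathbf j$-labelled, resp. $\mathbf m$-labelled, formula). A labelled proof system is a *proper labelled calculus* if for its inferences: * **C$_2$** Congruent parameters are occurrences of the same structure; congruent nonparametric structures of a switch rule have the same formula (resp. share a term) and differ in the label only. * **C$_3$** Each constituent of a premise is congruent to at most one constituent of the conclusion. * **C$_4$** Congruent constituents occur in the same position. * **C$_5$** A principal labelled formula is in display in the conclusion; and no two principal labelled formulas of the same inference with the same formula are in the same position. * **C$_6$ / C$_7$** The set of inferences is closed under simultaneous substitution of finite collections of structures for congruent non-principal labelled formulas in succedent / precedent position. Where a switch rule exchanges the label of the replaced formula, it is exchanged in the substituted structures displaying it. Substituted structures must not contain the labels of premises that do not occur in the conclusion, nor contain the label of a replaced formula other than in display,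 and the substitution (carried out for all the selected occurrences of a formula in the conclusion, including a principal one if selected) must yield a well-formed sequent. * **C$_8$** If both cut formulas of a cut are principal in the last inferences of the two subderivations, and these are otherwise cut-free, then the conclusion has a derivation in which every cut formula is a proper subformula of the original one, and in which the occurrences in the end-sequent that were $\mathbf j$-labelled (resp. $\mathbf m$-labelled) still are. Condition **C$_1$**: each formula occurring in a premise of an inference (other than a cut) is a subformula of some formula in the conclusion. **Theorem.** In every proper labelled calculus, every sequent that is derivable is derivable without cut. If moreover C$_1$ holds, the calculus has the subformula property: every derivable sequent has a cut-free derivation in which only subformulas of formulas of that sequent occur. -/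

import Mathlib

universe u

namespace LabCalc

/-! ### The language: formulas, terms, labelled formulas, pure structures, sequents -/

/-- A signature: propositional variables and connectives for the formulas, operation symbols for
the terms, and the two sorts of labels (nominals and conominals). -/
structure Signature where
  Atom : Type u
  Conn : Type u
  arity : Conn → ℕ
  Op : Type u
  opArity : Op → ℕ
  Nom : Type u
  Con : Type u

/-- Formulas of the original language of the logic. -/
inductive Fml (Sg : Signature.{u}) : Type u
  | atom (p : Sg.Atom) : Fml Sg
  | conn (c : Sg.Conn) (args : Fin (Sg.arity c) → Fml Sg) : Fml Sg

variable {Sg : Signature.{u}}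

/-- `A` is an immediate subformula of `B`. -/
def ImmSub (A B : Fml Sg) : Prop :=
  ∃ (c : Sg.Conn) (args : Fin (Sg.arity c) → Fml Sg) (i : Fin (Sg.arity c)),
    B = Fml.conn c args ∧ A = args i

/-- `A` is a subformula of `B`. -/
def Sub (A B : Fml Sg) : Prop := Relation.ReflTransGen ImmSub A B

/-- `A` is a proper subformula of `B`. -/
def ProperSub (A B : Fml Sg) : Prop := Relation.TransGen ImmSub A B

/-- The two kinds of labels. -/
inductive Kind
  | nom
  | con

inductive Label (Sg : Signature.{u}) : Type u
  | nom (j : Sg.Nom) : Label Sg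
  | con (m : Sg.Con) : Label Sg

def Label.kind : Label Sg → Kind
  | .nom _ => .nom
  | .con _ => .con

/-- Terms built from nominals and conominals, such as `j`, `◇ j`, `m`, `□ m`. -/
inductive Tm (Sg : Signature.{u}) : Type u
  | var (l : Label Sg) : Tm Sg
  | op (o : Sg.Op) (args : Fin (Sg.opArity o) → Tm Sg) : Tm Sg

def Tm.labels : Tm Sg → Set (Label Sg)
  | .var l => {l}
  | .op _ args => ⋃ i, (args i).labels

/-- Structures: the labelled formulas `j ≤ A` and `A ≤ m`, and the pure structures `S ≤ T`. -/
inductive Str (Sg : Signature.{u}) : Type u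
  | nomF (j : Sg.Nom) (A : Fml Sg) : Str Sg
  | conF (A : Fml Sg) (m : Sg.Con) : Str Sg
  | pure (S T : Tm Sg) : Str Sg

def Str.labels : Str Sg → Set (Label Sg)
  | .nomF j _ => {.nom j}
  | .conF _ m => {.con m}
  | .pure S T => S.labels ∪ T.labels

/-- The grammar of pure structures: they are of the form `j ≤ T` or `T ≤ m`, where the label
`j` (resp. `m`) does not occur in `T`. -/
def Str.Grammatical : Str Sg → Prop
  | .nomF _ _ => True
  | .conF _ _ => True
  | .pure S T =>
      (∃ j, S = .var (.nom j) ∧ Label.nom j ∉ T.labels) ∨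
      (∃ m, T = .var (.con m) ∧ Label.con m ∉ S.labels)

/-- `A` is the formula of the labelled formula `σ`. -/
def Str.HasFormula : Str Sg → Fml Sg → Prop
  | .nomF _ A, B => A = B
  | .conF A _, B => A = B
  | .pure _ _, _ => False

/-- The label `l` is in display in the structure `σ`. -/
def Str.Displays : Str Sg → Label Sg → Prop
  | .nomF j _, l => l = .nom j
  | .conF _ m, l => l = .con m
  | .pure S T, .nom j => S = .var (.nom j) ∧ Label.nom j ∉ T.labels
  | .pure S T, .con m => T = .var (.con m) ∧ Label.con m ∉ S.labels

/-- What a label is attached to: a formula or a term. -/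
abbrev Body (Sg : Signature.{u}) : Type u := Fml Sg ⊕ Tm Sg

def Body.labels : Body Sg → Set (Label Sg)
  | .inl _ => ∅
  | .inr T => T.labels

/-- The structure in which the body `X` has the label `l` in display: `j ≤ X` or `X ≤ m`. -/
def Body.at : Body Sg → Label Sg → Str Sg
  | .inl A, .nom j => .nomF j A
  | .inl A, .con m => .conF A m
  | .inr T, .nom j => .pure (.var (.nom j)) T
  | .inr T, .con m => .pure T (.var (.con m))

/-- The two sides of the turnstile. -/
inductive Side
  | left
  | right

/-- Precedent and succedent position. -/
inductive Pos
  | pre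
  | suc

/-- The side on which a structure with a label of the given kind has to stand in order to be in
the given position: `j ≤ X` is in precedent position on the left, `X ≤ m` on the right. -/
def Pos.side : Pos → Kind → Side
  | .pre, .nom => .left
  | .pre, .con => .right
  | .suc, .nom => .right
  | .suc, .con => .left

/-- An occurrence of a structure on one side of a sequent. -/
abbrev Occ (Sg : Signature.{u}) : Type u := Side × Str Sg

/-- A sequent `Γ ⊢ Δ` is a pair of finite multisets of structures, given as one multiset of
structures with their sides: `(left, σ)` for `σ` in `Γ`, `(right, σ)` for `σ` in `Δ`. -/
abbrev Sequent (Sg : Signature.{u}) : Type u := Multiset (Occ Sg)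

/-- The occurrence of `X` with label `l` in position `q`. -/
def place (l : Label Sg) (q : Pos) (X : Body Sg) : Occ Sg := (q.side l.kind, X.at l)

/-- The labelled formula with formula `A` and label `l`, in position `q`. -/
abbrev lf (l : Label Sg) (q : Pos) (A : Fml Sg) : Occ Sg := place l q (Sum.inl A)

/-- The occurrence `o` is in position `q`. -/
def InPos (o : Occ Sg) (q : Pos) : Prop := ∃ (l : Label Sg) (X : Body Sg), o = place l q X

/-! ### Renaming of labels -/

/-- Injective renamings of nominals and conominals. -/
structure Renaming (Sg : Signature.{u}) where
  nom : Equiv.Perm Sg.Nom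
  con : Equiv.Perm Sg.Con

def Label.rename (ρ : Renaming Sg) : Label Sg → Label Sg
  | .nom j => .nom (ρ.nom j)
  | .con m => .con (ρ.con m)

def Tm.rename (ρ : Renaming Sg) : Tm Sg → Tm Sg
  | .var l => .var (l.rename ρ)
  | .op o args => .op o (fun i => (args i).rename ρ)

def Str.rename (ρ : Renaming Sg) : Str Sg → Str Sg
  | .nomF j A => .nomF (ρ.nom j) A
  | .conF A m => .conF A (ρ.con m)
  | .pure S T => .pure (S.rename ρ) (T.rename ρ)

def Occ.rename (ρ : Renaming Sg) (o : Occ Sg) : Occ Sg := (o.1, o.2.rename ρ)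

/-! ### Analysed inferences -/

/-- A sequent presented as a finite family, so that its constituents can be told apart. -/
structure OccFam (Sg : Signature.{u}) where
  ι : Type
  fin : Finite ι
  occ : ι → Occ Sg

/-- The multiset of the values of a function on the constituents. -/
noncomputable def OccFam.collect {α : Type*} (s : OccFam Sg) (f : s.ι → α) : Multiset α :=
  haveI := s.fin
  letI := Fintype.ofFinite s.ι
  (Finset.univ : Finset s.ι).val.map f

noncomputable def OccFam.seq (s : OccFam Sg) : Sequent Sg := s.collect s.occ

def OccFam.labels (s : OccFam Sg) : Set (Label Sg) := ⋃ i, (s.occ i).2.labels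

def OccFam.rename (ρ : Renaming Sg) (s : OccFam Sg) : OccFam Sg where
  ι := s.ι
  fin := s.fin
  occ := fun i => Occ.rename ρ (s.occ i)

/-- An instance of a rule together with its analysis: which constituents are parameters, which
constituents of the premises are locally congruent to which constituents of the conclusion, and
whether the rule is a switch rule. Congruent constituents instantiate the same structure
metavariable (and are parameters), or are nonparametric structures in a switch rule. -/
structure Inference (Sg : Signature.{u}) where
  n : ℕ
  prem : Fin n → OccFam Sg
  concl : OccFam Sg
  isSwitch : Prop
  premParam : (i : Fin n) → (prem i).ι → Prop
  param : concl.ι → Prop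
  cong : (i : Fin n) → (prem i).ι → concl.ι → Prop
  cong_cases : ∀ i p c, cong i p c →
    (premParam i p ∧ param c) ∨ (isSwitch ∧ ¬ premParam i p ∧ ¬ param c)

/-- A constituent of the conclusion is principal if it is not a parameter and the rule is not a
switch rule. -/
def Inference.Principal (r : Inference Sg) (c : r.concl.ι) : Prop := ¬ r.param c ∧ ¬ r.isSwitch

def Inference.rename (ρ : Renaming Sg) (r : Inference Sg) : Inference Sg where
  n := r.n
  prem := fun i => (r.prem i).rename ρ
  concl := r.concl.rename ρ
  isSwitch := r.isSwitch
  premParam := r.premParam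
  param := r.param
  cong := r.cong
  cong_cases := r.cong_cases

/-! ### Substitution of structures for congruent labelled formulas -/

/-- A finite collection of structures to be substituted for a labelled formula. Each member is a
structure with a side (which stays as it is), or a body `X` with a position, which is attached to
the label of the labelled formula that is replaced: when a switch rule exchanges that label, the
same exchange takes place in these members. -/
structure Ctx (Sg : Signature.{u}) where
  ι : Type
  fin : Finite ι
  item : ι → Occ Sg ⊕ (Pos × Body Sg)

/-- The members of the collection for the label `l`. -/
def Ctx.fill (K : Ctx Sg) (l : Label Sg) (k : K.ι) : Occ Sg :=
  match K.item k with
  | .inl o => o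
  | .inr x => place l x.1 x.2

/-- The labels that occur in the collection independently of the label to be filled in. -/
def Ctx.labels (K : Ctx Sg) : Set (Label Sg) :=
  {l | ∃ k, match K.item k with
    | .inl o => l ∈ o.2.labels
    | .inr x => l ∈ Body.labels x.2}

def Ctx.Inner (K : Ctx Sg) (k : K.ι) : Prop := ∃ o, K.item k = .inl o

/-- What the member `k` of `K` becomes when `K` is substituted for the labelled formula `o`
(never used for pure structures `o`). -/
def Ctx.replace (K : Ctx Sg) (o : Occ Sg) (k : K.ι) : Occ Sg :=
  match o.2 with
  | .nomF j _ => K.fill (.nom j) k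
  | .conF _ m => K.fill (.con m) k
  | .pure _ _ => o

/-- Substitution of `K` for the constituents in `M`. -/
def OccFam.subst (s : OccFam Sg) (K : Ctx Sg) (M : Set s.ι) : OccFam Sg where
  ι := {i // i ∉ M} ⊕ ({i // i ∈ M} × K.ι)
  fin := by
    have := s.fin
    have := K.fin
    infer_instance
  occ := Sum.elim (fun i => s.occ i.1) (fun x => K.replace (s.occ x.1.1) x.2)

/-- The constituents of the `i`-th premise that are congruent to a member of `M`. -/
def Inference.up (r : Inference Sg) (M : Set r.concl.ι) (i : Fin r.n) : Set (r.prem i).ι :=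
  {p | ∃ c ∈ M, r.cong i p c}

/-- Simultaneous substitution of `K` for the constituents in `M` of the conclusion and for all
the constituents of the premises that are congruent to them. All other constituents keep their
role, and the copies of the members of `K` are congruent to each other. -/
def Inference.subst (r : Inference Sg) (K : Ctx Sg) (M : Set r.concl.ι) : Inference Sg where
  n := r.n
  prem := fun i => (r.prem i).subst K (r.up M i)
  concl := r.concl.subst K M
  isSwitch := r.isSwitch
  premParam := fun i => Sum.elim (fun p => r.premParam i p.1)
    (fun x => K.Inner x.2 ∨ r.premParam i x.1.1)
  param := Sum.elim (fun c => r.param c.1) (fun x => K.Inner x.2 ∨ r.param x.1.1)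
  cong := fun i p c =>
    match p, c with
    | .inl p, .inl c => r.cong i p.1 c.1
    | .inr x, .inr y => r.cong i x.1.1 y.1.1 ∧ x.2 = y.2
    | _, _ => False
  cong_cases := by
    rintro i (p | x) (c | y) h
    · exact r.cong_cases i _ _ h
    · exact h.elim
    · exact h.elim
    · obtain ⟨h1, h2⟩ := h
      by_cases hk : K.Inner x.2
      · exact Or.inl ⟨Or.inl hk, Or.inl (h2 ▸ hk)⟩
      · have hk' : ¬ K.Inner y.2 := h2 ▸ hk
        rcases r.cong_cases i _ _ h1 with h | h
        · exact Or.inl ⟨Or.inr h.1, Or.inr h.2⟩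
        · refine Or.inr ⟨h.1, ?_, ?_⟩
          · rintro (h' | h')
            · exact hk h'
            · exact h.2.1 h'
          · rintro (h' | h')
            · exact hk' h'
            · exact h.2.2 h'

/-! ### Proof systems and derivations -/

/-- A labelled proof system: a set of well-formed sequents and a set of instances of rules other
than cut. As rules are schemes with metavariables for labels, both are closed under injective
renaming. -/
structure ProofSystem (Sg : Signature.{u}) where
  wf : Sequent Sg → Prop
  wf_grammatical : ∀ s, wf s → ∀ o ∈ s, o.2.Grammatical
  wf_rename : ∀ (ρ : Renaming Sg) s, wf s → wf (s.map (Occ.rename ρ))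
  rules : Set (Inference Sg)
  rules_wf : ∀ r ∈ rules, wf r.concl.seq ∧ ∀ i, wf (r.prem i).seq
  rules_rename : ∀ (ρ : Renaming Sg), ∀ r ∈ rules, r.rename ρ ∈ rules
  /-- Side condition of switch rules: a label that is switched away from a formula does not
  occur in the conclusion. -/
  switch_side : ∀ r ∈ rules, r.isSwitch → ∀ i p c, r.cong i p c → ¬ r.param c →
    ∀ (l l' : Label Sg) (A : Fml Sg), ((r.prem i).occ p).2 = Body.at (Sum.inl A) l' →
      (r.concl.occ c).2 = Body.at (Sum.inl A) l → l' = l ∨ l' ∉ r.concl.labels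

/-- An occurrence in a derivation, with a tag. The tag `some κ` asserts that the occurrence is a
`κ`-labelled formula in the derivation: wherever one of the uppermost occurrences congruent to it
is principal, its label is of the kind `κ`. The tag `none` asserts nothing. -/
abbrev Item (Sg : Signature.{u}) : Type u := Occ Sg × Option Kind

noncomputable def OccFam.tagged (s : OccFam Sg) (t : s.ι → Option Kind) : Multiset (Item Sg) :=
  s.collect (fun i => (s.occ i, t i))

/-- Tags of the conclusion and of the premises of an inference which fit its analysis. -/
def Inference.Tagging (r : Inference Sg) (tc : r.concl.ι → Option Kind)
    (tp : (i : Fin r.n) → (r.prem i).ι → Option Kind) : Prop :=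
  (∀ i p c, r.cong i p c → tp i p = tc c) ∧
  (∀ c, r.Principal c → ∀ (l : Label Sg) (q : Pos) (A : Fml Sg), r.concl.occ c = lf l q A →
    ∀ κ, tc c = some κ → l.kind = κ)

/-- The label `l` is in display in the sequent. -/
def Displayed (l : Label Sg) (s : Multiset (Item Sg)) : Prop :=
  ∀ x ∈ s, l ∈ x.1.2.labels → x.1.2.Displays l

/-- The formula `B` occurs in the sequent (as the formula of a labelled formula). -/
def Occurs (B : Fml Sg) (s : Sequent Sg) : Prop := ∃ o ∈ s, o.2.HasFormula B

/-- `Derivable S Cuts Φ s`: the (tagged) sequent `s` has a derivation in `S` in which only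
formulas from `Cuts` are cut formulas and only formulas from `Φ` occur. In a cut, the labelled
cut formula is in display in both premises and is a nominal-labelled or a conominal-labelled
formula in both subderivations, according to the kind of its label. -/
inductive Derivable (S : ProofSystem Sg) (Cuts Φ : Fml Sg → Prop) : Multiset (Item Sg) → Prop
  | inf (r : Inference Sg) (hr : r ∈ S.rules) (tc : r.concl.ι → Option Kind)
      (tp : (i : Fin r.n) → (r.prem i).ι → Option Kind) (ht : r.Tagging tc tp)
      (hΦ : ∀ B, Occurs B r.concl.seq → Φ B)
      (hp : ∀ i, Derivable S Cuts Φ ((r.prem i).tagged (tp i))) :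
      Derivable S Cuts Φ (r.concl.tagged tc)
  | cut (l : Label Sg) (A : Fml Sg) (hA : Cuts A) (s₁ s₂ : Multiset (Item Sg))
      (hd₁ : Displayed l s₁) (hd₂ : Displayed l s₂)
      (hw : S.wf ((s₁ + s₂).map Prod.fst))
      (hΦ : ∀ B, Occurs B ((s₁ + s₂).map Prod.fst) → Φ B)
      (h₁ : Derivable S Cuts Φ ((lf l .suc A, some l.kind) ::ₘ s₁))
      (h₂ : Derivable S Cuts Φ ((lf l .pre A, some l.kind) ::ₘ s₂)) :
      Derivable S Cuts Φ (s₁ + s₂)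

/-- A sequent as the end-sequent of a derivation, nothing being asserted by tags. -/
def untagged (s : Sequent Sg) : Multiset (Item Sg) := s.map (fun o => (o, none))

namespace ProofSystem

variable (S : ProofSystem Sg)

/-- Derivability with cut. -/
def Provable (s : Sequent Sg) : Prop :=
  Derivable S (fun _ => True) (fun _ => True) (untagged s)

/-- Derivability without cut. -/
def CutFreeProvable (s : Sequent Sg) : Prop :=
  Derivable S (fun _ => False) (fun _ => True) (untagged s)

def CutElimination : Prop := ∀ s, S.Provable s → S.CutFreeProvable s

/-- Every provable sequent has a (cut-free) derivation in which only subformulas of its formulas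
occur. -/
def SubformulaProperty : Prop :=
  ∀ s, S.Provable s →
    Derivable S (fun _ => False) (fun B => ∃ A, Occurs A s ∧ Sub B A) (untagged s)

/-! ### Proper labelled calculi -/

/-- Preservation of formulas (in the rules other than cut). -/
def C1 : Prop :=
  ∀ r ∈ S.rules, ∀ i B, Occurs B (r.prem i).seq → ∃ A, Occurs A r.concl.seq ∧ Sub B A

/-- Shape-alikeness: congruent parameters are occurrences of the same structure, and congruent
nonparametric structures (of a switch rule) have the same formula, resp. share a term, and differ
in the label only. -/
def C2 : Prop :=
  ∀ r ∈ S.rules, ∀ i p c, r.cong i p c →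
    (r.param c → ((r.prem i).occ p).2 = (r.concl.occ c).2) ∧
    (¬ r.param c → ∃ (X : Body Sg) (l l' : Label Sg),
      ((r.prem i).occ p).2 = X.at l' ∧ (r.concl.occ c).2 = X.at l)

/-- Non-proliferation. -/
def C3 : Prop :=
  ∀ r ∈ S.rules, ∀ i p c c', r.cong i p c → r.cong i p c' → c = c'

/-- Position-alikeness. -/
def C4 : Prop :=
  ∀ r ∈ S.rules, ∀ i p c, r.cong i p c →
    ∃ q : Pos, InPos ((r.prem i).occ p) q ∧ InPos (r.concl.occ c) q

/-- Display of principal constituents. -/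
def C5 : Prop :=
  ∀ r ∈ S.rules, ∀ c, r.Principal c → ∀ (l : Label Sg) (q : Pos) (A : Fml Sg),
    r.concl.occ c = lf l q A →
      ∀ d, l ∈ (r.concl.occ d).2.labels → (r.concl.occ d).2.Displays l

/-- No formula is principal twice in the same position of the same inference. -/
def UniquePrincipal : Prop :=
  ∀ r ∈ S.rules, ∀ c c', r.Principal c → r.Principal c' →
    ∀ (l l' : Label Sg) (q : Pos) (A : Fml Sg),
      r.concl.occ c = lf l q A → r.concl.occ c' = lf l' q A → c = c'

/-- Closure of the rules under simultaneous substitution for congruent labelled formulas in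
position `q`. Here `M` is a set of occurrences of one formula `A` in the conclusion (with any
labels); those members of `M` that are not principal are replaced, together with all the
occurrences congruent to them. As usual, the substituted structures must not contain the labels
that are bound in the inference (those of a premise that do not occur in the conclusion), and the
substitution has to make sense, that is, it leads from `M` to a well-formed sequent. -/
def SubstClosed (q : Pos) : Prop :=
  ∀ r ∈ S.rules, ∀ (A : Fml Sg) (K : Ctx Sg) (M : Set r.concl.ι),
    (∀ c ∈ M, ∃ l, r.concl.occ c = lf l q A ∧ l ∉ K.labels) →
    (∀ i, ∀ l ∈ (r.prem i).labels, l ∉ r.concl.labels → l ∉ K.labels) →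
    S.wf (r.concl.subst K M).seq →
    r.subst K {c | c ∈ M ∧ ¬ r.Principal c} ∈ S.rules

/-- Closure under substitution for succedent parts. -/
def C6 : Prop := S.SubstClosed .suc

/-- Closure under substitution for precedent parts. -/
def C7 : Prop := S.SubstClosed .pre

/-- Eliminability of matching principal constituents: if both cut formulas have been introduced
as principal by the last inferences `r₁`, `r₂` of the two (otherwise cut-free) subderivations,
then the conclusion of the cut has a derivation, with the same tags, in which all cut formulas
are proper subformulas of the original one. -/
def C8 : Prop :=
  ∀ r₁ ∈ S.rules, ∀ r₂ ∈ S.rules, ∀ (l : Label Sg) (A : Fml Sg)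
    (a₁ : r₁.concl.ι) (a₂ : r₂.concl.ι),
    r₁.Principal a₁ → r₂.Principal a₂ →
    r₁.concl.occ a₁ = lf l .suc A → r₂.concl.occ a₂ = lf l .pre A →
    ∀ tc₁ tp₁ tc₂ tp₂, r₁.Tagging tc₁ tp₁ → r₂.Tagging tc₂ tp₂ →
    tc₁ a₁ = some l.kind → tc₂ a₂ = some l.kind →
    (∀ i, Derivable S (fun _ => False) (fun _ => True) ((r₁.prem i).tagged (tp₁ i))) →
    (∀ i, Derivable S (fun _ => False) (fun _ => True) ((r₂.prem i).tagged (tp₂ i))) →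
    ∀ s₁ s₂ : Multiset (Item Sg),
    r₁.concl.tagged tc₁ = (lf l .suc A, some l.kind) ::ₘ s₁ →
    r₂.concl.tagged tc₂ = (lf l .pre A, some l.kind) ::ₘ s₂ →
    S.wf ((s₁ + s₂).map Prod.fst) →
    Derivable S (fun B => ProperSub B A) (fun _ => True) (s₁ + s₂)

/-- Proper labelled calculi. -/
structure Proper : Prop where
  c2 : S.C2
  c3 : S.C3
  c4 : S.C4
  c5 : S.C5
  unique : S.UniquePrincipal
  c6 : S.C6
  c7 : S.C7
  c8 : S.C8

end ProofSystem

end LabCalc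

/-!
The proof is Belnap's argument for display calculi, adapted to labels. A cut on `A` with cut-free
premises is removed by tracing the cut formula upwards. In the left derivation, all occurrences
congruent to the cut formula are replaced by the rest of the right premise, which is a collection
of structures depending on the label `l` of the cut formula because `l` is in display there
(`exists_ctx_of_displayed`). The closure conditions C₆ and C₇ turn each inference into another
inference. Where an occurrence congruent to the cut formula is principal, a cut with the right
derivation remains to be made. The label there may be a label `l'` other than `l`, as switch rules
exchange labels, but its kind is that of `l`: this is what the tags record. Hence the right
derivation can be renamed from `l` to `l'` (`CutFree.relabel`). This traversal is
`CutFree.substitute`.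

The remaining cuts have a left cut formula that is principal, hence in display by C₅, so that the
same traversal applies to the right derivation (`cutFree_of_principal_left`). It leaves cuts whose
two cut formulas are principal, which C₈ replaces by cuts on proper subformulas; these are
admissible by well-founded induction on `A` (`cutAdmissible`).

Substitution must not put structures with labels that are bound in an inference in its scope. As
there are infinitely many nominals and conominals, bound labels can be renamed first. The induction
principle `CutFree.induction_fresh` builds this into inductions on cut-free derivations. The
subformula property is then immediate, since in a cut-free derivation C₁ passes from the conclusion
of each inference to its premises.
-/

namespace LabCalc

variable {Sg : Signature.{u}}

/-! ### Formulas -/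

theorem wellFounded_properSub : WellFounded (ProperSub (Sg := Sg)) := by
  refine WellFounded.transGen ⟨fun A => ?_⟩
  induction A with
  | atom p => exact ⟨_, fun B ⟨c, args, i, h, _⟩ => by cases h⟩
  | conn c args ih =>
    refine ⟨_, fun B ⟨c', args', i, h, h'⟩ => ?_⟩
    cases h
    exact h' ▸ ih i

/-! ### Renaming of labels -/

/-- The renaming leaves every label of the set unchanged. -/
def Renaming.Fixes (ρ : Renaming Sg) (Λ : Set (Label Sg)) : Prop := ∀ l ∈ Λ, l.rename ρ = l

/-- Composition of renamings, `ρ` being applied before `σ`. -/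
def Renaming.trans (ρ σ : Renaming Sg) : Renaming Sg := ⟨ρ.nom.trans σ.nom, ρ.con.trans σ.con⟩

theorem Label.kind_rename (ρ : Renaming Sg) (l : Label Sg) : (l.rename ρ).kind = l.kind := by
  cases l <;> rfl

theorem Label.rename_trans (ρ σ : Renaming Sg) (l : Label Sg) :
    l.rename (ρ.trans σ) = (l.rename ρ).rename σ := by
  cases l <;> rfl

theorem Tm.rename_trans (ρ σ : Renaming Sg) (T : Tm Sg) :
    T.rename (ρ.trans σ) = (T.rename ρ).rename σ := by
  induction T with
  | var l => simp [Tm.rename, Label.rename_trans]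
  | op o args ih => simp [Tm.rename, ih]

theorem Str.rename_trans (ρ σ : Renaming Sg) (x : Str Sg) :
    x.rename (ρ.trans σ) = (x.rename ρ).rename σ := by
  cases x <;> simp [Str.rename, Renaming.trans]
  exact ⟨Tm.rename_trans ρ σ _, Tm.rename_trans ρ σ _⟩

theorem Tm.rename_of_fixes {ρ : Renaming Sg} {T : Tm Sg} (h : ρ.Fixes T.labels) :
    T.rename ρ = T := by
  induction T with
  | var l => simp [Tm.rename, h l rfl]
  | op o args ih =>
    simp only [Tm.rename, Tm.op.injEq, heq_eq_eq, true_and]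
    exact funext fun i => ih i fun l hl => h l (Set.mem_iUnion.2 ⟨i, hl⟩)

theorem Str.rename_of_fixes {ρ : Renaming Sg} {x : Str Sg} (h : ρ.Fixes x.labels) :
    x.rename ρ = x := by
  cases x with
  | nomF j A => simpa [Label.rename, Str.rename] using h (.nom j) rfl
  | conF A m => simpa [Label.rename, Str.rename] using h (.con m) rfl
  | pure S T =>
    rw [Str.rename, Tm.rename_of_fixes fun l hl => h l (Or.inl hl),
      Tm.rename_of_fixes fun l hl => h l (Or.inr hl)]

theorem Occ.rename_of_fixes {ρ : Renaming Sg} {o : Occ Sg} (h : ρ.Fixes o.2.labels) :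
    Occ.rename ρ o = o := by
  rw [Occ.rename, Str.rename_of_fixes h]

theorem Occ.rename_place {ρ : Renaming Sg} {X : Body Sg} (h : ρ.Fixes X.labels) (l : Label Sg)
    (q : Pos) : Occ.rename ρ (place l q X) = place (l.rename ρ) q X := by
  rcases X with A | T
  · cases l <;> rfl
  · have := Tm.rename_of_fixes (T := T) h
    cases l <;> simp [Occ.rename, place, Body.at, Str.rename, Tm.rename, this, Label.kind_rename] <;>
      rfl

theorem Occ.rename_lf (ρ : Renaming Sg) (l : Label Sg) (q : Pos) (A : Fml Sg) :
    Occ.rename ρ (lf l q A) = lf (l.rename ρ) q A :=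
  Occ.rename_place (X := Sum.inl A) (fun _ h => absurd h (Set.notMem_empty _)) l q

theorem lf_inj {l l' : Label Sg} {q q' : Pos} {A B : Fml Sg} :
    lf l q A = lf l' q' B ↔ l = l' ∧ q = q' ∧ A = B := by
  constructor
  · cases l <;> cases l' <;> cases q <;> cases q' <;>
      simp +contextual [lf, place, Body.at, Pos.side, Label.kind]
  · rintro ⟨rfl, rfl, rfl⟩; rfl

theorem eq_lf_of_rename_eq_lf {ρ : Renaming Sg} {o : Occ Sg} {l : Label Sg} {q : Pos} {A : Fml Sg}
    (h : Occ.rename ρ o = lf l q A) : ∃ l', o = lf l' q A ∧ l'.kind = l.kind := by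
  obtain ⟨s, i | ⟨B, n⟩ | _⟩ := o <;> cases l <;>
    simp [Occ.rename, Str.rename, lf, place, Body.at] at h
  · exact ⟨.nom i, Prod.ext h.1 (congrArg (Str.nomF i) h.2.2), rfl⟩
  · exact ⟨.con n, Prod.ext h.1 (congrArg (Str.conF · n) h.2.1), rfl⟩

theorem eq_lf_of_inPos {o : Occ Sg} {q : Pos} {l : Label Sg} {A : Fml Sg} (h : InPos o q)
    (ho : o.2 = Body.at (Sum.inl A) l) : o = lf l q A := by
  obtain ⟨l', X, rfl⟩ := h
  rcases X with B | T <;> cases l <;> cases l' <;> simp [place, Body.at] at ho <;>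
    simp [lf, place, Body.at, ho, Label.kind]

theorem inPos_lf {l : Label Sg} {q q' : Pos} {A : Fml Sg} (h : InPos (lf l q A) q') : q' = q :=
  (lf_inj.1 (eq_lf_of_inPos h rfl)).2.1.symm

/-- Interchanging two labels of the same kind. -/
theorem exists_renaming_swap {l l' : Label Sg} (h : l.kind = l'.kind) :
    ∃ ρ : Renaming Sg, l.rename ρ = l' ∧ ∀ k, k ≠ l → k ≠ l' → k.rename ρ = k := by
  classical
  cases l with
  | nom j =>
    cases l' with
    | con m => cases h
    | nom j' =>
      refine ⟨⟨Equiv.swap j j', 1⟩, by simp [Label.rename], fun k h1 h2 => ?_⟩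
      cases k with
      | con m => simp [Label.rename]
      | nom i =>
        simp only [Label.rename, Label.nom.injEq]
        exact Equiv.swap_apply_of_ne_of_ne (by simpa using h1) (by simpa using h2)
  | con m =>
    cases l' with
    | nom j => cases h
    | con m' =>
      refine ⟨⟨1, Equiv.swap m m'⟩, by simp [Label.rename], fun k h1 h2 => ?_⟩
      cases k with
      | nom j => simp [Label.rename]
      | con i =>
        simp only [Label.rename, Label.con.injEq]
        exact Equiv.swap_apply_of_ne_of_ne (by simpa using h1) (by simpa using h2)

theorem exists_perm_fixing_avoiding {α : Type*} [Infinite α] (C Λ : Set α) (hC : C.Finite)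
    (hΛ : Λ.Finite) (B : Finset α) (hB : ∀ x ∈ B, x ∉ C) :
    ∃ σ : Equiv.Perm α, (∀ x ∈ C, σ x = x) ∧ ∀ x ∈ B, σ x ∉ Λ := by
  classical
  induction B using Finset.induction_on with
  | empty => exact ⟨1, by simp, by simp⟩
  | insert x B hx ih =>
    obtain ⟨σ, h1, h2⟩ := ih fun y hy => hB y (Finset.mem_insert_of_mem hy)
    -- A further interchange of `σ x` with a new `y` moves the image of `x` out of `Λ`.
    obtain ⟨y, hy⟩ := ((hC.union hΛ).union (B.image σ).finite_toSet).exists_notMem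
    simp only [Set.mem_union, not_or, Finset.mem_coe, Finset.mem_image, not_exists, not_and] at hy
    obtain ⟨⟨hyC, hyΛ⟩, hyB⟩ := hy
    have hxC := hB x (Finset.mem_insert_self _ _)
    refine ⟨σ.trans (Equiv.swap (σ x) y), fun c hc => ?_, fun z hz => ?_⟩
    · rw [Equiv.trans_apply, Equiv.swap_apply_of_ne_of_ne, h1 c hc]
      · exact fun e => hxC (σ.injective e ▸ hc)
      · rw [h1 c hc]; exact fun e => hyC (e ▸ hc)
    · rcases Finset.mem_insert.1 hz with rfl | hz
      · simpa using hyΛ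
      · rw [Equiv.trans_apply, Equiv.swap_apply_of_ne_of_ne]
        · exact h2 z hz
        · exact fun e => hx (σ.injective e ▸ hz)
        · exact hyB z hz

/-- A finite set of labels can be moved away from another finite set by a renaming that keeps
a third one fixed. -/
theorem exists_renaming_fresh [Infinite Sg.Nom] [Infinite Sg.Con] {B C Λ : Set (Label Sg)}
    (hB : B.Finite) (hC : C.Finite) (hΛ : Λ.Finite) :
    ∃ ρ : Renaming Sg, ρ.Fixes C ∧ ∀ l ∈ B, l ∉ C → l.rename ρ ∉ Λ := by
  have hn : Function.Injective (Label.nom : Sg.Nom → Label Sg) := fun _ _ h => by simpa using h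
  have hc : Function.Injective (Label.con : Sg.Con → Label Sg) := fun _ _ h => by simpa using h
  have key : ∀ {α : Type u} (f : α → Label Sg), Function.Injective f → Infinite α →
      ∃ σ : Equiv.Perm α, (∀ x, f x ∈ C → σ x = x) ∧
        ∀ x, f x ∈ B → f x ∉ C → f (σ x) ∉ Λ := by
    intro α f hf _
    obtain ⟨σ, h1, h2⟩ := exists_perm_fixing_avoiding (f ⁻¹' C) (f ⁻¹' Λ) (hC.preimage hf.injOn)
      (hΛ.preimage hf.injOn) ((hB.subset Set.sdiff_subset : (B \ C).Finite).preimage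
        (f := f) hf.injOn).toFinset (fun x hx => by simp at hx; exact hx.2)
    exact ⟨σ, h1, fun x hx hx' => h2 x (by simp [hx, hx'])⟩
  obtain ⟨σ, h1, h2⟩ := key _ hn inferInstance
  obtain ⟨τ, h3, h4⟩ := key _ hc inferInstance
  refine ⟨⟨σ, τ⟩, fun l hl => ?_, fun l hl hl' => ?_⟩
  · cases l with
    | nom j => exact congrArg _ (h1 j hl)
    | con m => exact congrArg _ (h3 m hl)
  · cases l with
    | nom j => exact h2 j hl hl'
    | con m => exact h4 m hl hl'

theorem Tm.finite_labels (T : Tm Sg) : T.labels.Finite := by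
  induction T with
  | var l => exact Set.finite_singleton l
  | op o args ih => exact Set.finite_iUnion ih

theorem Str.finite_labels (x : Str Sg) : x.labels.Finite := by
  cases x with
  | nomF j A => exact Set.finite_singleton _
  | conF A m => exact Set.finite_singleton _
  | pure S T => exact S.finite_labels.union T.finite_labels

theorem OccFam.finite_labels (s : OccFam Sg) : s.labels.Finite :=
  haveI := s.fin
  Set.finite_iUnion fun i => (s.occ i).2.finite_labels

theorem Ctx.finite_labels (K : Ctx Sg) : K.labels.Finite := by
  have := K.fin
  have : K.labels = ⋃ k, {l | match K.item k with
    | .inl o => l ∈ o.2.labels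
    | .inr x => l ∈ Body.labels x.2} := by
    ext
    rw [Set.mem_iUnion]
    rfl
  rw [this]
  refine Set.finite_iUnion fun k => ?_
  rcases K.item k with o | ⟨q, A | T⟩
  · exact o.2.finite_labels
  · exact Set.finite_empty
  · exact T.finite_labels

theorem Tm.labels_rename (ρ : Renaming Sg) (T : Tm Sg) :
    (T.rename ρ).labels = Label.rename ρ '' T.labels := by
  induction T with
  | var l => simp [Tm.rename, Tm.labels]
  | op o args ih => simp [Tm.rename, Tm.labels, ih, Set.image_iUnion]

theorem Str.labels_rename (ρ : Renaming Sg) (x : Str Sg) :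
    (x.rename ρ).labels = Label.rename ρ '' x.labels := by
  cases x <;> simp [Str.rename, Str.labels, Label.rename, Set.image_union, Tm.labels_rename]

theorem OccFam.labels_rename (ρ : Renaming Sg) (s : OccFam Sg) :
    (s.rename ρ).labels = Label.rename ρ '' s.labels := by
  simp only [OccFam.labels, Set.image_iUnion]
  exact Set.iUnion_congr fun i => Str.labels_rename ρ _

/-- Renaming of a tagged occurrence; the tag is kept. -/
def Item.rename (ρ : Renaming Sg) (x : Item Sg) : Item Sg := (Occ.rename ρ x.1, x.2)

theorem Item.rename_trans (ρ σ : Renaming Sg) (x : Item Sg) :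
    x.rename (ρ.trans σ) = (x.rename ρ).rename σ := by
  simp [Item.rename, Occ.rename, Str.rename_trans]

theorem OccFam.tagged_rename (ρ : Renaming Sg) (s : OccFam Sg) (t : s.ι → Option Kind) :
    (s.rename ρ).tagged t = (s.tagged t).map (Item.rename ρ) := by
  simp only [OccFam.tagged, OccFam.collect, Multiset.map_map]
  rfl

theorem OccFam.rename_of_fixes {ρ : Renaming Sg} {s : OccFam Sg} (h : ρ.Fixes s.labels) :
    s.rename ρ = s := by
  obtain ⟨ι, fin, occ⟩ := s
  simp only [OccFam.rename, OccFam.mk.injEq, heq_eq_eq, true_and]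
  exact funext fun i => Occ.rename_of_fixes fun l hl => h l (Set.mem_iUnion.2 ⟨i, hl⟩)

theorem Inference.Tagging.rename {r : Inference Sg} {tc : r.concl.ι → Option Kind}
    {tp : (i : Fin r.n) → (r.prem i).ι → Option Kind} (h : r.Tagging tc tp) (ρ : Renaming Sg) :
    (r.rename ρ).Tagging tc tp := by
  refine ⟨h.1, fun c hc l q A ho κ hκ => ?_⟩
  obtain ⟨l', ho', hk⟩ := eq_lf_of_rename_eq_lf ho
  exact hk ▸ h.2 c hc l' q A ho' κ hκ

/-! ### Cut-free derivations -/

/-- Cut-free derivability of tagged sequents. -/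
abbrev CutFree (S : ProofSystem Sg) (s : Multiset (Item Sg)) : Prop :=
  Derivable S (fun _ => False) (fun _ => True) s

theorem CutFree.rename {S : ProofSystem Sg} {s : Multiset (Item Sg)} (h : CutFree S s)
    (ρ : Renaming Sg) : CutFree S (s.map (Item.rename ρ)) := by
  induction h with
  | inf r hr tc tp ht hΦ hp ih =>
    rw [← OccFam.tagged_rename]
    refine Derivable.inf (r.rename ρ) (S.rules_rename ρ r hr) tc tp (ht.rename ρ)
      (fun _ _ => trivial) fun i => ?_
    have := ih i
    rwa [← OccFam.tagged_rename] at this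
  | cut l A hA => exact hA.elim

/-- Induction on cut-free derivations in which the labels that disappear in an inference may be
assumed to avoid a given finite set. -/
theorem CutFree.induction_fresh [Infinite Sg.Nom] [Infinite Sg.Con] {S : ProofSystem Sg}
    {Λ : Set (Label Sg)} (hΛ : Λ.Finite) {P : Multiset (Item Sg) → Prop}
    (step : ∀ r ∈ S.rules, ∀ tc tp, r.Tagging tc tp →
      (∀ i, ∀ l ∈ (r.prem i).labels, l ∉ r.concl.labels → l ∉ Λ) →
      (∀ i, P ((r.prem i).tagged (tp i))) → P (r.concl.tagged tc))
    {s : Multiset (Item Sg)} (h : CutFree S s) : P s := by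
  -- The claim is proved for all renamings of `s`, as renaming the bound labels of an inference
  -- renames the derivations of its premises.
  suffices H : ∀ ρ : Renaming Sg, P (s.map (Item.rename ρ)) by
    have hid : s.map (Item.rename ⟨1, 1⟩) = s.map id := Multiset.map_congr rfl fun x _ =>
      Prod.ext (Occ.rename_of_fixes fun l _ => by cases l <;> rfl) rfl
    rw [← s.map_id, ← hid]
    exact H _
  induction h with
  | cut l A hA => exact hA.elim
  | inf r hr tc tp ht hΦ hp ih =>
    intro ρ
    obtain ⟨σ, hσ, hσ'⟩ := exists_renaming_fresh (B := ⋃ i, ((r.rename ρ).prem i).labels)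
      (C := (r.rename ρ).concl.labels) (Set.finite_iUnion fun i => OccFam.finite_labels _)
      (OccFam.finite_labels _) hΛ
    have hconcl := OccFam.rename_of_fixes hσ
    have hlab : ((r.rename ρ).rename σ).concl.labels = (r.rename ρ).concl.labels :=
      congrArg OccFam.labels hconcl
    have := step ((r.rename ρ).rename σ) (S.rules_rename σ _ (S.rules_rename ρ r hr)) tc tp
      ((ht.rename ρ).rename σ) (fun i l hl hl' => ?_) fun i => ?_
    · rw [← OccFam.tagged_rename]
      convert this using 1
      simp only [OccFam.tagged, OccFam.collect]
      refine Multiset.map_congr rfl fun c _ => Prod.ext ?_ rfl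
      exact (Occ.rename_of_fixes fun l hl => hσ l (Set.mem_iUnion.2 ⟨c, hl⟩)).symm
    · have hl2 : l ∈ (((r.rename ρ).prem i).rename σ).labels := hl
      rw [OccFam.labels_rename] at hl2
      obtain ⟨k, hk, rfl⟩ := hl2
      rw [hlab] at hl'
      refine hσ' k (Set.mem_iUnion.2 ⟨i, hk⟩) fun hkC => hl' ?_
      rwa [hσ k hkC]
    · have := ih i (ρ.trans σ)
      rw [Multiset.map_congr rfl fun x _ => Item.rename_trans ρ σ x,
        ← Function.comp_def, ← Multiset.map_map, ← OccFam.tagged_rename] at this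
      exact (OccFam.tagged_rename σ ((r.prem i).rename ρ) (tp i)).symm ▸ this

/-! ### Constituents and substitution -/

theorem OccFam.tagged_map_fst (s : OccFam Sg) (t : s.ι → Option Kind) :
    (s.tagged t).map Prod.fst = s.seq := by
  simp only [OccFam.tagged, OccFam.seq, OccFam.collect, Multiset.map_map]
  rfl

theorem OccFam.collect_eq (s : OccFam Sg) [Fintype s.ι] {α : Type*} (f : s.ι → α) :
    s.collect f = (Finset.univ : Finset s.ι).val.map f := by
  unfold OccFam.collect
  convert rfl

open Classical in
/-- The tagged constituents whose indices belong to `M`. -/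
noncomputable def OccFam.part (s : OccFam Sg) (t : s.ι → Option Kind) (M : Set s.ι) :
    Multiset (Item Sg) :=
  haveI := s.fin
  letI := Fintype.ofFinite s.ι
  (Finset.univ.filter (· ∈ M)).val.map fun i => (s.occ i, t i)

theorem OccFam.mem_part {s : OccFam Sg} {t : s.ι → Option Kind} {M : Set s.ι} {x : Item Sg} :
    x ∈ s.part t M ↔ ∃ i ∈ M, (s.occ i, t i) = x := by
  simp [OccFam.part]

theorem OccFam.part_add_part_compl (s : OccFam Sg) (t : s.ι → Option Kind) (M : Set s.ι) :
    s.part t M + s.part t Mᶜ = s.tagged t := by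
  classical
  let := s.fin
  let := Fintype.ofFinite s.ι
  rw [OccFam.tagged, OccFam.collect_eq]
  simp only [OccFam.part, ← Multiset.map_add, Set.mem_compl_iff]
  rw [Finset.filter_val, Finset.filter_val, Multiset.filter_add_not]

theorem OccFam.part_insert (s : OccFam Sg) (t : s.ι → Option Kind) {M : Set s.ι} {c : s.ι}
    (hc : c ∉ M) : s.part t (insert c M) = (s.occ c, t c) ::ₘ s.part t M := by
  classical
  let := s.fin
  let := Fintype.ofFinite s.ι
  simp only [OccFam.part]
  rw [← Multiset.map_cons (fun i => (s.occ i, t i)), ← Finset.insert_val_of_notMem (by simpa using hc)]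
  congr 2
  ext i
  simp

theorem exists_subset_map_eq_of_map_eq_add {ι α : Type*} [DecidableEq ι] (F : ι → α)
    (a b : Multiset α) (T : Finset ι) (h : T.val.map F = a + b) :
    ∃ M ⊆ T, M.val.map F = a ∧ (T \ M).val.map F = b := by
  induction a using Multiset.induction_on generalizing T with
  | empty => exact ⟨∅, by simp, by simp, by simpa using h⟩
  | cons x a ih =>
    have hx : x ∈ T.val.map F := by rw [h]; simp
    obtain ⟨i, hi, rfl⟩ := Multiset.mem_map.1 hx
    have hi : i ∈ T := hi
    rw [← Finset.insert_erase hi, Finset.insert_val_of_notMem (Finset.notMem_erase i T),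
      Multiset.map_cons, Multiset.cons_add, Multiset.cons_inj_right] at h
    obtain ⟨M, hM, h1, h2⟩ := ih (T.erase i) h
    have hiM : i ∉ M := fun hm => Finset.notMem_erase i T (hM hm)
    refine ⟨insert i M, ?_, ?_, ?_⟩
    · exact Finset.insert_subset hi (hM.trans (Finset.erase_subset i T))
    · rw [Finset.insert_val_of_notMem hiM, Multiset.map_cons, h1]
    · rw [← h2]
      congr 2
      ext j
      simp
      tauto

theorem OccFam.exists_part {s : OccFam Sg} {t : s.ι → Option Kind} {a b : Multiset (Item Sg)}
    (h : s.tagged t = a + b) : ∃ M : Set s.ι, s.part t M = a ∧ s.part t Mᶜ = b := by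
  classical
  let := s.fin
  let := Fintype.ofFinite s.ι
  rw [OccFam.tagged, OccFam.collect_eq] at h
  obtain ⟨M, -, rfl, rfl⟩ := exists_subset_map_eq_of_map_eq_add _ a b _ h
  refine ⟨M, ?_, ?_⟩ <;> simp only [OccFam.part] <;> congr 2 <;> ext i <;> simp

/-- What becomes of a labelled formula under substitution of `K`, the members of `K` being tagged
by `u`. -/
noncomputable def Ctx.plug (K : Ctx Sg) (u : K.ι → Option Kind) (x : Item Sg) :
    Multiset (Item Sg) :=
  haveI := K.fin
  letI := Fintype.ofFinite K.ι
  (Finset.univ : Finset K.ι).val.map fun k => (K.replace x.1 k, u k)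

theorem Ctx.replace_lf (K : Ctx Sg) (l : Label Sg) (q : Pos) (A : Fml Sg) :
    K.replace (lf l q A) = K.fill l := by
  cases l <;> rfl

/-- Tags after substitution: the members of `K` are tagged by `u`, the other constituents keep
their tags. -/
def OccFam.substTag (s : OccFam Sg) (t : s.ι → Option Kind) (K : Ctx Sg) (u : K.ι → Option Kind)
    (M : Set s.ι) : (s.subst K M).ι → Option Kind :=
  Sum.elim (fun i => t i.1) (fun x => u x.2)

theorem OccFam.tagged_subst (s : OccFam Sg) (t : s.ι → Option Kind) (K : Ctx Sg)
    (u : K.ι → Option Kind) (M : Set s.ι) :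
    (s.subst K M).tagged (s.substTag t K u M) =
      s.part t Mᶜ + (s.part t M).bind (K.plug u) := by
  classical
  let := s.fin
  let := Fintype.ofFinite s.ι
  let := K.fin
  let := Fintype.ofFinite K.ι
  have hsum : ∀ {ι : Type} (T : Finset ι) (f : ι → Item Sg), T.val.map f = ∑ i ∈ T, {f i} := by
    intro ι T f
    rw [Finset.sum, ← Multiset.sum_map_singleton (T.val.map f), Multiset.map_map]
    rfl
  have key : (s.subst K M).tagged (s.substTag t K u M) = _ :=
    @OccFam.collect_eq Sg (s.subst K M)
      (@instFintypeSum {i // i ∉ M} ({i // i ∈ M} × K.ι) inferInstance inferInstance) _ _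
  rw [key, hsum]
  have hbind : (s.part t M).bind (K.plug u) =
      ∑ i ∈ Finset.univ.filter (· ∈ M), K.plug u (s.occ i, t i) := by
    rw [OccFam.part, Multiset.bind_map]
    rfl
  rw [hbind]
  simp only [OccFam.part, Ctx.plug, hsum]
  refine (Fintype.sum_sum_type (α₁ := {i // i ∉ M}) (α₂ := {i // i ∈ M} × K.ι) _).trans ?_
  congr 1
  · refine Eq.trans ?_ (Finset.sum_subtype (p := (· ∉ M)) (F := inferInstance) _
      (by simp) _).symm
    rfl
  · rw [Fintype.sum_prod_type]
    exact (Finset.sum_subtype (p := (· ∈ M)) (Finset.univ.filter (· ∈ M)) (by simp)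
      fun i => ∑ k, ({(K.replace (s.occ i) k, u k)} : Multiset (Item Sg))).symm

/-! ### Sequents as substitutable collections -/

theorem exists_side_eq (s : Side) (κ : Kind) : ∃ q : Pos, q.side κ = s := by
  cases s <;> cases κ
  exacts [⟨.pre, rfl⟩, ⟨.suc, rfl⟩, ⟨.suc, rfl⟩, ⟨.pre, rfl⟩]

theorem eq_place_of_displays {o : Occ Sg} {l : Label Sg} (h : o.2.Displays l) :
    ∃ q X, o = place l q X ∧ l ∉ X.labels := by
  obtain ⟨s, ⟨i, B⟩ | ⟨B, n⟩ | ⟨S, T⟩⟩ := o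
  · obtain rfl : l = .nom i := h
    obtain ⟨q, rfl⟩ := exists_side_eq s .nom
    exact ⟨q, .inl B, rfl, Set.notMem_empty _⟩
  · obtain rfl : l = .con n := h
    obtain ⟨q, rfl⟩ := exists_side_eq s .con
    exact ⟨q, .inl B, rfl, Set.notMem_empty _⟩
  · cases l with
    | nom j =>
      obtain ⟨rfl, h⟩ := h
      obtain ⟨q, rfl⟩ := exists_side_eq s .nom
      exact ⟨q, .inr T, rfl, h⟩
    | con m =>
      obtain ⟨rfl, h⟩ := h
      obtain ⟨q, rfl⟩ := exists_side_eq s .con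
      exact ⟨q, .inr S, rfl, h⟩

theorem Ctx.rename_fill {K : Ctx Sg} {ρ : Renaming Sg} (h : ρ.Fixes K.labels) (l : Label Sg)
    (k : K.ι) : Occ.rename ρ (K.fill l k) = K.fill (l.rename ρ) k := by
  unfold Ctx.fill
  have hk : ∀ l', (match K.item k with
    | .inl o => l' ∈ o.2.labels
    | .inr x => l' ∈ Body.labels x.2) → l'.rename ρ = l' := fun l' hl' => h l' ⟨k, hl'⟩
  revert hk
  rcases K.item k with o | x
  · exact fun hk => Occ.rename_of_fixes hk
  · exact fun hk => Occ.rename_place hk l x.1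

/-- The members of `K` for the label `l`, tagged by `u`. -/
noncomputable def Ctx.filled (K : Ctx Sg) (u : K.ι → Option Kind) (l : Label Sg) :
    Multiset (Item Sg) :=
  haveI := K.fin
  letI := Fintype.ofFinite K.ι
  (Finset.univ : Finset K.ι).val.map fun k => (K.fill l k, u k)

theorem Ctx.plug_lf (K : Ctx Sg) (u : K.ι → Option Kind) (l : Label Sg) (q : Pos) (A : Fml Sg)
    (κ : Option Kind) : K.plug u (lf l q A, κ) = K.filled u l := by
  simp only [Ctx.plug, Ctx.filled, Ctx.replace_lf]

theorem Ctx.rename_filled {K : Ctx Sg} {ρ : Renaming Sg} (h : ρ.Fixes K.labels)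
    (u : K.ι → Option Kind) (l : Label Sg) :
    (K.filled u l).map (Item.rename ρ) = K.filled u (l.rename ρ) := by
  simp only [Ctx.filled, Multiset.map_map, Function.comp_def, Item.rename, Ctx.rename_fill h]

/-- A sequent in which `l` is in display is a collection of structures with `l` filled in. -/
theorem exists_ctx_of_displayed {l : Label Sg} {s : Multiset (Item Sg)} (h : Displayed l s) :
    ∃ (K : Ctx Sg) (u : K.ι → Option Kind), K.filled u l = s ∧ l ∉ K.labels := by
  have hitem : ∀ x ∈ s, ∃ y : Occ Sg ⊕ (Pos × Body Sg),
      (match y with | .inl o => o | .inr z => place l z.1 z.2) = x.1 ∧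
      ¬ (match y with | .inl o => l ∈ o.2.labels | .inr z => l ∈ Body.labels z.2) := by
    intro x hx
    by_cases hl : l ∈ x.1.2.labels
    · obtain ⟨q, X, h1, h2⟩ := eq_place_of_displays (h x hx hl)
      exact ⟨.inr (q, X), h1.symm, h2⟩
    · exact ⟨.inl x.1, rfl, hl⟩
  obtain ⟨L, rfl⟩ := Quot.exists_rep s
  choose f hf hf' using hitem
  set K : Ctx Sg := ⟨Fin L.length, inferInstance, fun k => f (L.get k) (List.get_mem L k)⟩
  refine ⟨K, fun k : Fin L.length => (L.get k).2, ?_, ?_⟩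
  · have hfill : ∀ k : Fin L.length, (K.fill l k, (L.get k).2) = L.get k :=
      fun k => Prod.ext (hf _ (List.get_mem L k)) rfl
    refine (Multiset.map_congr rfl fun k _ => hfill k).trans ?_
    have huniv : (Finset.univ : Finset (Fin L.length)).val.map L.get = L := by
      rw [Fin.univ_val_map, List.ofFn_get]
    refine Eq.trans ?_ huniv
    convert rfl
  · rintro ⟨k, hk⟩
    exact hf' _ (List.get_mem L k) hk

/-- The label `l` of a labelled formula, if it is in display in the rest `K.filled u l` of the
sequent, can be replaced by any label of the same kind that does not occur in `K`. -/
theorem CutFree.relabel {S : ProofSystem Sg} {K : Ctx Sg} {u : K.ι → Option Kind}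
    {l l' : Label Sg} {q : Pos} {A : Fml Sg} {κ : Option Kind} (hk : l.kind = l'.kind)
    (hl : l ∉ K.labels) (hl' : l' ∉ K.labels)
    (h : CutFree S ((lf l q A, κ) ::ₘ K.filled u l)) :
    CutFree S ((lf l' q A, κ) ::ₘ K.filled u l') := by
  obtain ⟨ρ, rfl, hρ⟩ := exists_renaming_swap hk
  have := h.rename ρ
  rwa [Multiset.map_cons, Ctx.rename_filled (fun k hkK =>
    hρ k (fun e => hl (e ▸ hkK)) (fun e => hl' (e ▸ hkK))), Item.rename, Occ.rename_lf] at this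

/-! ### Substitution in cut-free derivations -/

/-- A constituent congruent to a labelled formula is the same formula in the same position, and
its label is the same or is bound in the inference. -/
theorem lf_of_cong {S : ProofSystem Sg} (hS : S.Proper) {r : Inference Sg} (hr : r ∈ S.rules)
    {i : Fin r.n} {p : (r.prem i).ι} {c : r.concl.ι} (h : r.cong i p c) {l : Label Sg} {q : Pos}
    {A : Fml Sg} (hc : r.concl.occ c = lf l q A) :
    ∃ l', (r.prem i).occ p = lf l' q A ∧ (l' = l ∨ l' ∉ r.concl.labels) := by
  obtain ⟨q', hp, hc'⟩ := hS.c4 r hr i p c h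
  rw [hc] at hc'
  obtain rfl := inPos_lf hc'
  by_cases hpar : r.param c
  · have := (hS.c2 r hr i p c h).1 hpar
    rw [hc] at this
    exact ⟨l, eq_lf_of_inPos hp this, Or.inl rfl⟩
  · obtain ⟨X, k, k', h1, h2⟩ := (hS.c2 r hr i p c h).2 hpar
    have hsw : r.isSwitch := by
      rcases r.cong_cases i p c h with h | h
      exacts [absurd h.2 hpar, h.1]
    rw [hc] at h2
    have hX : X = Sum.inl A := by
      rcases X with B | T <;> cases k <;> cases l <;> simp [lf, place, Body.at] at h2 <;> simp [h2]
    subst hX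
    refine ⟨k', eq_lf_of_inPos hp h1, ?_⟩
    exact S.switch_side r hr hsw i p c h hpar l k' A h1 (congrArg Prod.snd hc)

/-- The copies of the members of `K` can be tagged as one likes, since they are congruent only to
copies of the same member and none of them becomes principal. -/
theorem Inference.Tagging.subst {r : Inference Sg} {tc : r.concl.ι → Option Kind}
    {tp : (i : Fin r.n) → (r.prem i).ι → Option Kind} (h : r.Tagging tc tp) (K : Ctx Sg)
    (u : K.ι → Option Kind) (M : Set r.concl.ι) (hM : ∀ c ∈ M, ¬ r.Principal c) :
    (r.subst K M).Tagging (r.concl.substTag tc K u M)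
      (fun i => (r.prem i).substTag (tp i) K u (r.up M i)) := by
  constructor
  · rintro i (p | x) (c | y) hpc
    · exact h.1 i _ _ hpc
    · exact hpc.elim
    · exact hpc.elim
    · exact congrArg u hpc.2
  · rintro (c | x) hc l q A ho κ hκ
    · exact h.2 c.1 hc l q A ho κ hκ
    · exact absurd ⟨fun hp => hc.1 (Or.inr hp), hc.2⟩ (hM x.1.1 x.1.2)

/-- Replacing labelled formulas `A` in position `q` of a cut-free derivable sequent by `K`. All
occurrences congruent to them are replaced simultaneously up to those that are principal; there,
the hypothesis `base` is used, which replaces a single principal occurrence. -/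
theorem CutFree.substitute [Infinite Sg.Nom] [Infinite Sg.Con] {S : ProofSystem Sg}
    (hS : S.Proper) {q : Pos} {A : Fml Sg} {κ : Kind} {K : Ctx Sg} {u : K.ι → Option Kind}
    (base : ∀ r ∈ S.rules, ∀ c, r.Principal c → ∀ l, l.kind = κ → l ∉ K.labels →
      r.concl.occ c = lf l q A → ∀ tc tp, r.Tagging tc tp → tc c = some κ →
      (∀ i, CutFree S ((r.prem i).tagged (tp i))) →
      ∀ s, r.concl.tagged tc = (lf l q A, some κ) ::ₘ s →
      S.wf ((s + K.filled u l).map Prod.fst) → CutFree S (s + K.filled u l))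
    {s : Multiset (Item Sg)} (h : CutFree S s) :
    ∀ a b, s = a + b → (∀ x ∈ a, ∃ l, l ∉ K.labels ∧ x = (lf l q A, some κ)) →
      S.wf ((b + a.bind (K.plug u)).map Prod.fst) → CutFree S (b + a.bind (K.plug u)) := by
  have hclosed : S.SubstClosed q := by
    cases q
    exacts [hS.c7, hS.c6]
  refine CutFree.induction_fresh (P := fun s => ∀ a b, s = a + b →
    (∀ x ∈ a, ∃ l, l ∉ K.labels ∧ x = (lf l q A, some κ)) →
    S.wf ((b + a.bind (K.plug u)).map Prod.fst) → CutFree S (b + a.bind (K.plug u)))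
    K.finite_labels ?_ h
  intro r hr tc tp ht hfresh ih a b hab ha hw
  obtain ⟨M, rfl, rfl⟩ := OccFam.exists_part hab
  have hM : ∀ c ∈ M, ∃ l, l ∉ K.labels ∧ r.concl.occ c = lf l q A ∧ tc c = some κ := by
    intro c hc
    obtain ⟨l, hl, he⟩ := ha _ (OccFam.mem_part.2 ⟨c, hc, rfl⟩)
    exact ⟨l, hl, congrArg Prod.fst he, congrArg Prod.snd he⟩
  rw [← OccFam.tagged_subst, OccFam.tagged_map_fst] at hw
  set M' : Set r.concl.ι := {c | c ∈ M ∧ ¬ r.Principal c} with hM'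
  have hr' : r.subst K M' ∈ S.rules := hclosed r hr A K M
    (fun c hc => by obtain ⟨l, h1, h2, -⟩ := hM c hc; exact ⟨l, h2, h1⟩) hfresh hw
  have ht' := ht.subst K u M' fun c hc => hc.2
  -- The premises of the new inference are well-formed because it is an inference of the system,
  -- so the induction hypotheses apply to them.
  have hprem : ∀ i, CutFree S (((r.prem i).subst K (r.up M' i)).tagged
      ((r.prem i).substTag (tp i) K u (r.up M' i))) := by
    intro i
    have hw' := (S.rules_wf _ hr').2 i
    rw [OccFam.tagged_subst]
    refine ih i _ _ (OccFam.part_add_part_compl _ _ _).symm ?_ ?_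
    · intro x hx
      obtain ⟨p, ⟨c, hc, hpc⟩, rfl⟩ := OccFam.mem_part.1 hx
      obtain ⟨l, hl, ho, htag⟩ := hM c hc.1
      obtain ⟨l', ho', hl'⟩ := lf_of_cong hS hr hpc ho
      refine ⟨l', ?_, by rw [ho', ht.1 i p c hpc, htag]⟩
      rcases hl' with rfl | hl'
      · exact hl
      · refine hfresh i l' (Set.mem_iUnion.2 ⟨p, ?_⟩) hl'
        rw [ho']
        cases l' <;> exact rfl
    · rw [← OccFam.tagged_subst, OccFam.tagged_map_fst]
      exact hw'
  have hmain : CutFree S ((r.concl.subst K M').tagged (r.concl.substTag tc K u M')) :=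
    Derivable.inf _ hr' _ _ ht' (fun _ _ => trivial) hprem
  have e := r.concl.tagged_subst tc K u M'
  by_cases hex : ∃ c ∈ M, r.Principal c
  · obtain ⟨c, hc, hcp⟩ := hex
    obtain ⟨l, hl, ho, htag⟩ := hM c hc
    have hcM' : c ∉ M' := fun h => h.2 hcp
    -- By uniqueness, `c` is the only principal member of `M`.
    have hins : M = insert c M' := by
      ext d
      constructor
      · intro hd
        by_cases hdp : r.Principal d
        · obtain ⟨l', -, ho', -⟩ := hM d hd
          exact Or.inl (hS.unique r hr d c hdp hcp l' l q A ho' ho)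
        · exact Or.inr ⟨hd, hdp⟩
      · rintro (rfl | hd)
        exacts [hc, hd.1]
    have hcompl : M'ᶜ = insert c Mᶜ := by
      ext d
      by_cases hdc : d = c <;> simp [hins, hdc, hcM']
    have hsplit : r.concl.part tc Mᶜ + (r.concl.part tc M).bind (K.plug u) =
        (r.concl.part tc Mᶜ + (r.concl.part tc M').bind (K.plug u)) + K.filled u l := by
      have : r.concl.part tc M = (lf l q A, some κ) ::ₘ r.concl.part tc M' := by
        rw [← ho, ← htag, ← OccFam.part_insert _ _ hcM', ← hins]
      rw [this, Multiset.cons_bind, Ctx.plug_lf]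
      abel
    rw [← OccFam.tagged_map_fst _ (r.concl.substTag tc K u M),
      OccFam.tagged_subst, hsplit] at hw
    rw [hsplit]
    refine base _ hr' (Sum.inl ⟨c, hcM'⟩) hcp l (ht.2 c hcp l q A ho κ htag) hl ho _ _ ht' htag
      hprem _ ?_ hw
    refine e.trans ?_
    rw [hcompl, OccFam.part_insert _ _ (by simpa using hc), ho, htag, Multiset.cons_add]
  · have : M' = M := by
      ext d
      exact ⟨fun hd => hd.1, fun hd => ⟨hd, fun hp => hex ⟨d, hd, hp⟩⟩⟩
    rw [this] at e hmain
    rw [← e]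
    exact hmain

theorem CutFree.substitute_single [Infinite Sg.Nom] [Infinite Sg.Con] {S : ProofSystem Sg}
    (hS : S.Proper) {q : Pos} {A : Fml Sg} {κ : Kind} {K : Ctx Sg} {u : K.ι → Option Kind}
    (base : ∀ r ∈ S.rules, ∀ c, r.Principal c → ∀ l, l.kind = κ → l ∉ K.labels →
      r.concl.occ c = lf l q A → ∀ tc tp, r.Tagging tc tp → tc c = some κ →
      (∀ i, CutFree S ((r.prem i).tagged (tp i))) →
      ∀ s, r.concl.tagged tc = (lf l q A, some κ) ::ₘ s →
      S.wf ((s + K.filled u l).map Prod.fst) → CutFree S (s + K.filled u l))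
    {l : Label Sg} (hl : l ∉ K.labels) {s : Multiset (Item Sg)}
    (h : CutFree S ((lf l q A, some κ) ::ₘ s)) (hw : S.wf ((s + K.filled u l).map Prod.fst)) :
    CutFree S (s + K.filled u l) := by
  have := CutFree.substitute hS base h {(lf l q A, some κ)} s (Multiset.singleton_add _ _).symm
    (fun x hx => ⟨l, hl, Multiset.mem_singleton.1 hx⟩)
  rw [Multiset.singleton_bind, Ctx.plug_lf] at this
  exact this hw

/-! ### Elimination of cuts -/

/-- The labelled formulas `A` can be cut in cut-free derivations. -/
def CutAdmissible (S : ProofSystem Sg) (A : Fml Sg) : Prop :=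
  ∀ (l : Label Sg) (s₁ s₂ : Multiset (Item Sg)), Displayed l s₂ →
    S.wf ((s₁ + s₂).map Prod.fst) →
    CutFree S ((lf l .suc A, some l.kind) ::ₘ s₁) →
    CutFree S ((lf l .pre A, some l.kind) ::ₘ s₂) → CutFree S (s₁ + s₂)

/-- If the cut formulas of a derivation can be cut in cut-free derivations, then the uppermost cuts
can be removed successively. -/
theorem Derivable.cutFree {S : ProofSystem Sg} {Cuts Φ : Fml Sg → Prop}
    (hC : ∀ A, Cuts A → CutAdmissible S A) {s : Multiset (Item Sg)} (h : Derivable S Cuts Φ s) :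
    CutFree S s := by
  induction h with
  | inf r hr tc tp ht hΦ hp ih => exact .inf r hr tc tp ht (fun _ _ => trivial) ih
  | cut l A hA s₁ s₂ hd₁ hd₂ hw hΦ h₁ h₂ ih₁ ih₂ => exact hC A hA l s₁ s₂ hd₂ hw ih₁ ih₂

/-- A principal labelled formula is in display, so the rest of the conclusion can be substituted
for another occurrence of it. -/
theorem exists_ctx_of_principal {S : ProofSystem Sg} (hS : S.Proper) {r : Inference Sg}
    (hr : r ∈ S.rules) {c : r.concl.ι} (hc : r.Principal c) {l : Label Sg} {q : Pos} {A : Fml Sg}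
    (ho : r.concl.occ c = lf l q A) {tc : r.concl.ι → Option Kind} {κ : Option Kind}
    {s : Multiset (Item Sg)} (hs : r.concl.tagged tc = (lf l q A, κ) ::ₘ s) :
    ∃ (K : Ctx Sg) (u : K.ι → Option Kind), K.filled u l = s ∧ l ∉ K.labels := by
  refine exists_ctx_of_displayed fun x hx hl => ?_
  have hx' : x ∈ r.concl.tagged tc := hs ▸ Multiset.mem_cons_of_mem hx
  simp only [OccFam.tagged, OccFam.collect, Multiset.mem_map] at hx'
  obtain ⟨d, -, rfl⟩ := hx'
  exact hS.c5 r hr c hc l q A ho d hl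

section

variable [Infinite Sg.Nom] [Infinite Sg.Con] {S : ProofSystem Sg}

/-- A cut whose left cut formula is principal. The rest of the left premise is substituted for the
cut formula in the right derivation; where the latter is principal, C₈ applies to the left premise
with its label renamed. -/
theorem cutFree_of_principal_left (hS : S.Proper) {A : Fml Sg}
    (hA : ∀ B, ProperSub B A → CutAdmissible S B) {r : Inference Sg} (hr : r ∈ S.rules)
    {c : r.concl.ι} (hc : r.Principal c) {l : Label Sg} (ho : r.concl.occ c = lf l .suc A)
    {tc : r.concl.ι → Option Kind} {tp : (i : Fin r.n) → (r.prem i).ι → Option Kind}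
    (ht : r.Tagging tc tp) (htc : tc c = some l.kind)
    (hp : ∀ i, CutFree S ((r.prem i).tagged (tp i))) {s₁ s₂ : Multiset (Item Sg)}
    (hs₁ : r.concl.tagged tc = (lf l .suc A, some l.kind) ::ₘ s₁)
    (h₂ : CutFree S ((lf l .pre A, some l.kind) ::ₘ s₂))
    (hw : S.wf ((s₁ + s₂).map Prod.fst)) : CutFree S (s₁ + s₂) := by
  obtain ⟨K, u, rfl, hl⟩ := exists_ctx_of_principal hS hr hc ho hs₁
  rw [add_comm] at hw ⊢
  refine CutFree.substitute_single hS ?_ hl h₂ hw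
  intro r₂ hr₂ c₂ hc₂ l' hk hl' ho₂ tc₂ tp₂ ht₂ htc₂ hp₂ s hs hw'
  obtain ⟨ρ, rfl, hρ⟩ := exists_renaming_swap hk.symm
  have hfix : ρ.Fixes K.labels := fun k hkK =>
    hρ k (fun e => hl (e ▸ hkK)) (fun e => hl' (e ▸ hkK))
  rw [add_comm] at hw' ⊢
  rw [← hk] at hs htc₂
  refine (hS.c8 (r.rename ρ) (S.rules_rename ρ r hr) r₂ hr₂ (l.rename ρ) A c c₂ hc hc₂ ?_ ho₂
    tc tp tc₂ tp₂ (ht.rename ρ) ht₂ (by rw [hk, htc]) htc₂ (fun i => ?_) hp₂ _ _ ?_ hs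
    hw').cutFree hA
  · exact (congrArg (Occ.rename ρ) ho).trans (Occ.rename_lf ρ l _ A)
  · have := (hp i).rename ρ
    rw [← OccFam.tagged_rename] at this
    exact this
  · refine (OccFam.tagged_rename ρ r.concl tc).trans ?_
    rw [hs₁, Multiset.map_cons, Ctx.rename_filled hfix, Item.rename, Occ.rename_lf, hk]

theorem cutAdmissible (hS : S.Proper) (A : Fml Sg) : CutAdmissible S A := by
  induction A using wellFounded_properSub.induction with
  | _ A hA =>
  intro l s₁ s₂ hd hw h₁ h₂
  obtain ⟨K, u, rfl, hl⟩ := exists_ctx_of_displayed hd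
  refine CutFree.substitute_single hS ?_ hl h₁ hw
  intro r hr c hc l' hk hl' ho tc tp ht htc hp s hs hw'
  rw [← hk] at htc hs
  refine cutFree_of_principal_left hS hA hr hc ho ht htc hp hs ?_ hw'
  rw [hk]
  exact h₂.relabel hk.symm hl hl'

end

/-! ### The subformula property -/

theorem CutFree.subformula {S : ProofSystem Sg} (hC : S.C1) {Φ : Fml Sg → Prop}
    (hΦ : ∀ A B, Sub B A → Φ A → Φ B) {s : Multiset (Item Sg)} (h : CutFree S s)
    (hs : ∀ B, Occurs B (s.map Prod.fst) → Φ B) : Derivable S (fun _ => False) Φ s := by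
  induction h with
  | cut l A hA => exact hA.elim
  | inf r hr tc tp ht _ hp ih =>
    rw [OccFam.tagged_map_fst] at hs
    refine .inf r hr tc tp ht hs fun i => ih i fun B hB => ?_
    rw [OccFam.tagged_map_fst] at hB
    obtain ⟨A, hA, hBA⟩ := hC r hr i B hB
    exact hΦ A B hBA (hs A hA)

end LabCalc

theorem mainTheorem2 (Sg : LabCalc.Signature.{u}) [Infinite Sg.Nom] [Infinite Sg.Con]
    (S : LabCalc.ProofSystem Sg) (hS : S.Proper) :
    S.CutElimination ∧ (S.C1 → S.SubformulaProperty) := by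
  have hcut : S.CutElimination := fun s hs => hs.cutFree fun A _ => LabCalc.cutAdmissible hS A
  refine ⟨hcut, fun hC s hs => LabCalc.CutFree.subformula hC ?_ (hcut s hs) ?_⟩
  · rintro A B hBA ⟨C, hC, hAC⟩
    exact ⟨C, hC, hBA.trans hAC⟩
  · intro B hB
    rw [LabCalc.untagged, Multiset.map_map] at hB
    exact ⟨B, by simpa using hB, .refl⟩
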